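/- A represented space is a set $X$ with a surjective partial map $\delta_X:\subseteq\mathbb{N}^{\mathbb{N}}\to X$; a partial multi-valued function $f:\subseteq X\rightrightarrows Y$ between represented spaces assigns to each $x\in X$ a set $f(x)\subseteq Y$, and $\operatorname{dom}(f)=\{x: f(x)\neq\emptyset\}$. A partial function $F:\subseteq\mathbb{N}^{\mathbb{N}}\to\mathbb{N}^{\mathbb{N}}$ is a realizer of $f$, written $F\vdash f$, if $F(p)$ is defined and $\delta_Y(F(p))\in f(\delta_X(p))$ for every $p\in\operatorname{dom}(\delta_X)$ with $\delta_X(p)\in\operatorname{dom}(f)$. Call $f$ Weihrauch reducible to $g$, written $f\leq_{\mathrm W} g$, if there are computable $K,H:\subseteq\mathbb{N}^{\mathbb{N}}\to\mathbb{N}^{\mathbb{N}}$ such that $K\langle \mathrm{id},GH\rangle\vdash f$ for all $G\vdash g$. The Weihrauch degrees are the equivalence classes of multi-valued functions on represented spaces under $\equiv_{\mathrm W}$, partially ordered by $\leq_{\mathrm W}$, together with an additional top element $\infty$; $0$ denotes the degree of the nowhere defined multi-valued function. The meet of degrees is induced by the operation that takes $f:\subseteq X\rightrightarrows Y$ and $g:\subseteq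 U\rightrightarrows V$ to $f\sqcap g:\subseteq X\times U\rightrightarrows Y\sqcup V$ with domain $\operatorname{dom}(f)\times\operatorname{dom}(g)$ and $(f\sqcap g)(x,u)=(\{0\}\times f(x))\cup(\{1\}\times g(u))$, and $\mathbf a\sqcap\infty=\infty\sqcap\mathbf a=\mathbf a$. A degree $\mathbf a$ is called $\sqcap$-irreducible if $\mathbf a=\mathbf b\sqcap\mathbf c$ implies $\mathbf a=\mathbf b$ or $\mathbf a=\mathbf c$, for all degrees $\mathbf b,\mathbf c$. **Theorem.** A Weihrauch degree $\mathbf a$ is $\sqcap$-irreducible if and only if $\mathbf a=0$ or $\mathbf a=\infty$. Moreover, for every Weihrauch degree $\mathbf a\notin\{0,\infty\}$ there are Weihrauch degrees $\mathbf b,\mathbf c$ with $\mathbf a<_{\mathrm W}\mathbf b$, $\mathbf a<_{\mathrm W}\mathbf c$ and $\mathbf a=\mathbf b\sqcap\mathbf c$. -/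

import Mathlib

/-! ### Computable partial functions on Baire space -/

/-- Baire space `ℕ^ℕ`. -/
abbrev Baire : Type := ℕ → ℕ

/-- The partial recursive functionals `Φ : ℕ^ℕ × ℕ ⇀ ℕ`, that is, the functionals computed by
oracle machines: the least class which contains zero, successor, the two projections of the
pairing of `ℕ`, and evaluation of the oracle, and which is closed under pairing, composition,
primitive recursion and unbounded search. The clauses are those of `Nat.RecursiveIn`, with one
program that works for all oracles. -/
inductive PartrecFunctional : (Baire → ℕ →. ℕ) → Prop
  | zero : PartrecFunctional fun _ _ => Part.some 0
  | succ : PartrecFunctional fun _ n => Part.some (n + 1)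
  | left : PartrecFunctional fun _ n => Part.some n.unpair.1
  | right : PartrecFunctional fun _ n => Part.some n.unpair.2
  | oracle : PartrecFunctional fun p n => Part.some (p n)
  | pair {Φ Ψ : Baire → ℕ →. ℕ} (hΦ : PartrecFunctional Φ) (hΨ : PartrecFunctional Ψ) :
      PartrecFunctional fun p n => Nat.pair <$> Φ p n <*> Ψ p n
  | comp {Φ Ψ : Baire → ℕ →. ℕ} (hΦ : PartrecFunctional Φ) (hΨ : PartrecFunctional Ψ) :
      PartrecFunctional fun p n => Ψ p n >>= Φ p
  | prec {Φ Ψ : Baire → ℕ →. ℕ} (hΦ : PartrecFunctional Φ) (hΨ : PartrecFunctional Ψ) :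
      PartrecFunctional fun p m =>
        let (a, n) := Nat.unpair m
        n.rec (Φ p a) fun y IH => do
          let i ← IH
          Ψ p (Nat.pair a (Nat.pair y i))
  | rfind {Φ : Baire → ℕ →. ℕ} (hΦ : PartrecFunctional Φ) :
      PartrecFunctional fun p a => Nat.rfind fun n => (fun m => m = 0) <$> Φ p (Nat.pair a n)

/-- A partial function `F` on Baire space is computable if a single oracle machine computes, for
every `p` in the domain of `F`, the sequence `F p` from the oracle `p`. -/
def BaireComputable (F : Baire →. Baire) : Prop :=
  ∃ Φ, PartrecFunctional Φ ∧ ∀ p, ∀ q ∈ F p, ∀ n, q n ∈ Φ p n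

namespace Baire

/-- The pairing `⟨p, q⟩` on Baire space. -/
def pair (p q : Baire) : Baire := fun n => Nat.pair (p n) (q n)

/-- The first component of the inverse of the pairing. -/
def fst (r : Baire) : Baire := fun n => (r n).unpair.1

/-- The second component of the inverse of the pairing. -/
def snd (r : Baire) : Baire := fun n => (r n).unpair.2

/-- The sequence `k p`, with `k` put in front of `p`. -/
def cons (k : ℕ) (p : Baire) : Baire := fun n => Nat.casesOn n k p

/-- The sequence `p` without its first entry. -/
def tail (p : Baire) : Baire := fun n => p (n + 1)

@[simp] theorem fst_pair (p q : Baire) : fst (pair p q) = p := by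
  funext n; simp [fst, pair]

@[simp] theorem snd_pair (p q : Baire) : snd (pair p q) = q := by
  funext n; simp [snd, pair]

@[simp] theorem tail_cons (k : ℕ) (p : Baire) : tail (cons k p) = p := rfl

@[simp] theorem cons_zero (k : ℕ) (p : Baire) : cons k p 0 = k := rfl

end Baire

/-! ### Represented spaces, multi-valued functions, realizers -/

/-- A represented space: a set with a partial surjection from Baire space onto it. (A set of this
kind has at most the cardinality of the continuum, so `Type` is no restriction.) -/
structure RepresentedSpace where
  /-- The points. -/
  carrier : Type
  /-- The representation. -/
  rep : Baire →. carrier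
  /-- The representation is surjective. -/
  surj : ∀ x, ∃ p, x ∈ rep p

namespace RepresentedSpace

/-- The product, with `δ⟨p, q⟩ = (δ_X p, δ_Y q)`. -/
def prod (X Y : RepresentedSpace) : RepresentedSpace where
  carrier := X.carrier × Y.carrier
  rep := fun r => (X.rep r.fst).bind fun x => (Y.rep r.snd).map fun y => (x, y)
  surj := by
    rintro ⟨x, y⟩
    obtain ⟨p, hp⟩ := X.surj x
    obtain ⟨q, hq⟩ := Y.surj y
    exact ⟨Baire.pair p q, by simpa using ⟨hp, hq⟩⟩

/-- The coproduct, with `δ(0p) = (0, δ_X p)` and `δ(1p) = (1, δ_Y p)`; sequences with another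
first entry are not names. -/
def coprod (X Y : RepresentedSpace) : RepresentedSpace where
  carrier := X.carrier ⊕ Y.carrier
  rep := fun r =>
    match r 0 with
    | 0 => (X.rep r.tail).map Sum.inl
    | 1 => (Y.rep r.tail).map Sum.inr
    | _ => Part.none
  surj := by
    rintro (x | y)
    · obtain ⟨p, hp⟩ := X.surj x
      exact ⟨Baire.cons 0 p, by simpa using hp⟩
    · obtain ⟨p, hp⟩ := Y.surj y
      exact ⟨Baire.cons 1 p, by simpa using hp⟩

theorem mem_prod_rep {X Y : RepresentedSpace} {r : Baire} {z : X.carrier × Y.carrier} :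
    z ∈ (X.prod Y).rep r ↔ z.1 ∈ X.rep r.fst ∧ z.2 ∈ Y.rep r.snd := by
  obtain ⟨x, y⟩ := z
  refine Part.mem_bind_iff.trans ⟨?_, fun h => ⟨x, h.1, Part.mem_map _ h.2⟩⟩
  rintro ⟨a, ha, h⟩
  obtain ⟨b, hb, h⟩ := (Part.mem_map_iff _).1 h
  cases h
  exact ⟨ha, hb⟩

theorem mem_coprod_rep_inl {X Y : RepresentedSpace} {r : Baire} {x : X.carrier} :
    Sum.inl x ∈ (X.coprod Y).rep r ↔ r 0 = 0 ∧ x ∈ X.rep r.tail := by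
  change Sum.inl x ∈ (match r 0 with
    | 0 => (X.rep r.tail).map Sum.inl
    | 1 => (Y.rep r.tail).map Sum.inr
    | _ => Part.none : Part (X.carrier ⊕ Y.carrier)) ↔ _
  split <;> simp_all

theorem mem_coprod_rep_inr {X Y : RepresentedSpace} {r : Baire} {y : Y.carrier} :
    Sum.inr y ∈ (X.coprod Y).rep r ↔ r 0 = 1 ∧ y ∈ Y.rep r.tail := by
  change Sum.inr y ∈ (match r 0 with
    | 0 => (X.rep r.tail).map Sum.inl
    | 1 => (Y.rep r.tail).map Sum.inr
    | _ => Part.none : Part (X.carrier ⊕ Y.carrier)) ↔ _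
  split <;> simp_all

end RepresentedSpace

/-- A (partial) multi-valued function `f : ⊆ X ⇉ Y` between represented spaces. -/
structure MultiFun where
  /-- The source. -/
  source : RepresentedSpace
  /-- The target. -/
  target : RepresentedSpace
  /-- The set of values at a point; it is empty exactly outside the domain. -/
  val : source.carrier → Set target.carrier

namespace MultiFun

/-- The domain of a multi-valued function. -/
def dom (f : MultiFun) : Set f.source.carrier := {x | (f.val x).Nonempty}

/-- `F` is a realizer of `f`: for every name `p` of a point `x` of the domain of `f`, `F p` is
defined and it is a name of an element of `f x`. -/
def Realizes (F : Baire →. Baire) (f : MultiFun) : Prop :=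
  ∀ p, ∀ x ∈ f.source.rep p, x ∈ f.dom → ∃ q ∈ F p, ∃ y ∈ f.target.rep q, y ∈ f.val x

/-- The partial function `K⟨id, GH⟩` on Baire space. -/
def transform (K H G : Baire →. Baire) : Baire →. Baire :=
  fun p => (H p).bind fun u => (G u).bind fun v => K (Baire.pair p v)

theorem mem_transform {K H G : Baire →. Baire} {p q : Baire} :
    q ∈ transform K H G p ↔ ∃ u ∈ H p, ∃ v ∈ G u, q ∈ K (Baire.pair p v) := by
  unfold transform
  exact Part.mem_bind_iff.trans (exists_congr fun u => and_congr_right fun _ => Part.mem_bind_iff)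

/-- Weihrauch reducibility. -/
def WeihrauchReducible (f g : MultiFun) : Prop :=
  ∃ K H : Baire →. Baire, BaireComputable K ∧ BaireComputable H ∧
    ∀ G, Realizes G g → Realizes (transform K H G) f

/-- The meet `f ⊓ g : ⊆ X × U ⇉ Y ⊔ V`, with domain `dom f × dom g` and
`(f ⊓ g)(x, u) = {0} × f x ∪ {1} × g u` there. -/
def meet (f g : MultiFun) : MultiFun where
  source := f.source.prod g.source
  target := f.target.coprod g.target
  val := fun xu =>
    {z | xu.1 ∈ f.dom ∧ xu.2 ∈ g.dom ∧ z ∈ Sum.inl '' f.val xu.1 ∪ Sum.inr '' g.val xu.2}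

end MultiFun

/-- Baire space as a represented space, with the identity as representation. -/
def RepresentedSpace.baire : RepresentedSpace where
  carrier := Baire
  rep := fun p => Part.some p
  surj := fun p => ⟨p, Part.mem_some p⟩

/-- The nowhere defined multi-valued function on Baire space. -/
def MultiFun.nowhere : MultiFun where
  source := .baire
  target := .baire
  val := fun _ => ∅

/-! ### Closure properties of computability, needed for the order and the meet of degrees -/

namespace PartrecFunctional

theorem ofPartrec {f : ℕ →. ℕ} (hf : Nat.Partrec f) : PartrecFunctional fun _ => f := by
  induction hf with
  | zero => exact zero
  | succ => exact succ
  | left => exact left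
  | right => exact right
  | pair _ _ h1 h2 => exact pair h1 h2
  | comp _ _ h1 h2 => exact comp h1 h2
  | prec _ _ h1 h2 => exact prec h1 h2
  | rfind _ h1 => exact rfind h1

theorem ofPrimrec {f : ℕ → ℕ} (hf : Primrec f) :
    PartrecFunctional fun _ n => Part.some (f n) :=
  ofPartrec (Nat.Partrec.of_primrec (Primrec.nat_iff.1 hf))

/-- Substitution of a functional for the oracle. -/
theorem subst {Φ Ψ : Baire → ℕ →. ℕ} (hΦ : PartrecFunctional Φ) (hΨ : PartrecFunctional Ψ) :
    ∃ Θ, PartrecFunctional Θ ∧ ∀ p q : Baire, (∀ n, q n ∈ Ψ p n) → Θ p = Φ q := by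
  induction hΦ with
  | zero => exact ⟨_, zero, fun _ _ _ => rfl⟩
  | succ => exact ⟨_, succ, fun _ _ _ => rfl⟩
  | left => exact ⟨_, left, fun _ _ _ => rfl⟩
  | right => exact ⟨_, right, fun _ _ _ => rfl⟩
  | oracle => exact ⟨_, hΨ, fun p q h => funext fun n => Part.eq_some_iff.2 (h n)⟩
  | pair _ _ h1 h2 =>
    obtain ⟨A, hA, eA⟩ := h1
    obtain ⟨B, hB, eB⟩ := h2
    exact ⟨_, pair hA hB, fun p q h => by rw [eA p q h, eB p q h]⟩
  | comp _ _ h1 h2 =>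
    obtain ⟨A, hA, eA⟩ := h1
    obtain ⟨B, hB, eB⟩ := h2
    exact ⟨_, comp hA hB, fun p q h => by rw [eA p q h, eB p q h]⟩
  | prec _ _ h1 h2 =>
    obtain ⟨A, hA, eA⟩ := h1
    obtain ⟨B, hB, eB⟩ := h2
    exact ⟨_, prec hA hB, fun p q h => by rw [eA p q h, eB p q h]⟩
  | rfind _ h1 =>
    obtain ⟨A, hA, eA⟩ := h1
    exact ⟨_, rfind hA, fun p q h => by rw [eA p q h]⟩

/-- The functional which is `Φ` where `Ψ` is positive, and `0` where `Ψ` is `0`. -/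
theorem guard {Φ Ψ : Baire → ℕ →. ℕ} (hΦ : PartrecFunctional Φ) (hΨ : PartrecFunctional Ψ) :
    ∃ Θ, PartrecFunctional Θ ∧ ∀ p n b, b ∈ Ψ p n →
      (b = 0 → 0 ∈ Θ p n) ∧ (b ≠ 0 → ∀ m ∈ Φ p n, m ∈ Θ p n) := by
  refine ⟨_, comp (prec zero (comp hΦ left)) (pair (ofPrimrec Primrec.id) hΨ), ?_⟩
  intro p n b hb
  have e : Ψ p n = Part.some b := Part.eq_some_iff.2 hb
  simp only [e, Part.map_eq_map, Part.map_some, Part.bind_eq_bind, Part.bind_some, Seq.seq,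
    Nat.unpair_pair, id]
  refine ⟨by rintro rfl; exact Part.mem_some _, fun h0 m hm => ?_⟩
  have e' : Φ p n = Part.some m := Part.eq_some_iff.2 hm
  have key : ∀ k : ℕ, (Nat.rec (Part.some 0)
      (fun _ IH => IH.bind fun _ => (Part.some n).bind (Φ p)) (k + 1) :
      Part ℕ) = Part.some m := by
    intro k
    induction k with
    | zero => exact (Part.bind_some _ _).trans ((Part.bind_some _ _).trans e')
    | succ k ih =>
      change Part.bind _ _ = _
      rw [ih]
      exact (Part.bind_some _ _).trans ((Part.bind_some _ _).trans e')
  obtain ⟨k, rfl⟩ := Nat.exists_eq_succ_of_ne_zero h0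
  exact Part.eq_some_iff.1 (key k)

end PartrecFunctional

namespace BaireComputable

open PartrecFunctional

theorem id : BaireComputable fun p => Part.some p :=
  ⟨_, oracle, fun p q hq n => by
    rw [Part.mem_some_iff] at hq
    subst hq
    exact Part.mem_some _⟩

theorem comp {F G : Baire →. Baire} (hG : BaireComputable G) (hF : BaireComputable F) :
    BaireComputable fun p => (F p).bind G := by
  obtain ⟨Φ, hΦ, eΦ⟩ := hF
  obtain ⟨Ψ, hΨ, eΨ⟩ := hG
  obtain ⟨Θ, hΘ, eΘ⟩ := PartrecFunctional.subst hΨ hΦ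
  refine ⟨Θ, hΘ, fun p q hq n => ?_⟩
  obtain ⟨u, hu, hq⟩ := Part.mem_bind_iff.1 hq
  rw [eΘ p u (eΦ p u hu)]
  exact eΨ u q hq n

theorem pair {F G : Baire →. Baire} (hF : BaireComputable F) (hG : BaireComputable G) :
    BaireComputable fun p => (F p).bind fun u => (G p).bind fun v =>
      Part.some (Baire.pair u v) := by
  obtain ⟨Φ, hΦ, eΦ⟩ := hF
  obtain ⟨Ψ, hΨ, eΨ⟩ := hG
  refine ⟨_, PartrecFunctional.pair hΦ hΨ, fun p q hq n => ?_⟩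
  simp only [Part.mem_bind_iff, Part.mem_some_iff] at hq
  obtain ⟨u, hu, v, hv, rfl⟩ := hq
  rw [Part.eq_some_iff.2 (eΦ p u hu n), Part.eq_some_iff.2 (eΨ p v hv n)]
  simp [Seq.seq, Baire.pair]

/-- Application of a primitive recursive function to every entry. -/
theorem map {f : ℕ → ℕ} (hf : Primrec f) : BaireComputable fun p => Part.some fun n => f (p n) :=
  ⟨_, PartrecFunctional.comp (ofPrimrec hf) oracle, fun p q hq n => by
    rw [Part.mem_some_iff] at hq
    subst hq
    simp⟩

/-- Passage to the subsequence along a primitive recursive function. -/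
theorem reindex {f : ℕ → ℕ} (hf : Primrec f) :
    BaireComputable fun p => Part.some fun n => p (f n) :=
  ⟨_, PartrecFunctional.comp oracle (ofPrimrec hf), fun p q hq n => by
    rw [Part.mem_some_iff] at hq
    subst hq
    simp⟩

theorem fst : BaireComputable fun p => Part.some p.fst :=
  map (Primrec.fst.comp Primrec.unpair)

theorem snd : BaireComputable fun p => Part.some p.snd :=
  map (Primrec.snd.comp Primrec.unpair)

theorem tail : BaireComputable fun p => Part.some p.tail :=
  reindex Primrec.succ

/-- Case distinction on the first entry of the second component. -/
theorem cond {F G : Baire →. Baire} (hF : BaireComputable F) (hG : BaireComputable G) :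
    BaireComputable fun p => if p.snd 0 = 0 then F p else G p := by
  obtain ⟨Φ, hΦ, eΦ⟩ := hF
  obtain ⟨Ψ, hΨ, eΨ⟩ := hG
  have h0 : PartrecFunctional fun p _ => Part.some (p.snd 0) := by
    simpa [Baire.snd] using PartrecFunctional.comp
      (ofPrimrec (Primrec.snd.comp Primrec.unpair))
      (PartrecFunctional.comp oracle (ofPrimrec (Primrec.const 0)))
  have h1 : PartrecFunctional fun p _ => Part.some (1 - p.snd 0) := by
    simpa using PartrecFunctional.comp
      (ofPrimrec (Primrec.nat_sub.comp (Primrec.const 1) Primrec.id)) h0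
  obtain ⟨A, hA, eA⟩ := guard hΦ h1
  obtain ⟨B, hB, eB⟩ := guard hΨ h0
  refine ⟨_, PartrecFunctional.comp (ofPrimrec (f := fun n => n.unpair.1 + n.unpair.2)
    (Primrec.nat_add.comp (Primrec.fst.comp Primrec.unpair) (Primrec.snd.comp Primrec.unpair)))
    (PartrecFunctional.pair hA hB), fun p q hq n => ?_⟩
  have kA := eA p n _ (Part.mem_some _)
  have kB := eB p n _ (Part.mem_some _)
  by_cases hp : p.snd 0 = 0
  · replace hq : q ∈ F p := by simpa only [if_pos hp] using hq
    rw [Part.eq_some_iff.2 (kA.2 (by omega) _ (eΦ p q hq n)), Part.eq_some_iff.2 (kB.1 hp)]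
    simp [Seq.seq]
  · replace hq : q ∈ G p := by simpa only [if_neg hp] using hq
    rw [Part.eq_some_iff.2 (kA.1 (by omega)), Part.eq_some_iff.2 (kB.2 hp _ (eΨ p q hq n))]
    simp [Seq.seq]

theorem cons (k : ℕ) : BaireComputable fun p => Part.some (Baire.cons k p) := by
  have hk : PartrecFunctional fun _ _ => Part.some k := ofPrimrec (Primrec.const k)
  have hr : Primrec fun n : ℕ => n - 1 := Primrec.pred
  obtain ⟨A, hA, eA⟩ := guard (PartrecFunctional.comp oracle (ofPrimrec hr))
    (ofPrimrec Primrec.id)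
  obtain ⟨B, hB, eB⟩ := guard hk
    (ofPrimrec (Primrec.nat_sub.comp (Primrec.const 1) Primrec.id))
  refine ⟨_, PartrecFunctional.comp (ofPrimrec (f := fun n => n.unpair.1 + n.unpair.2)
    (Primrec.nat_add.comp (Primrec.fst.comp Primrec.unpair) (Primrec.snd.comp Primrec.unpair)))
    (PartrecFunctional.pair hA hB), fun p q hq n => ?_⟩
  rw [Part.mem_some_iff] at hq
  subst hq
  have kA := eA p n _ (Part.mem_some _)
  have kB := eB p n _ (Part.mem_some _)
  cases n with
  | zero =>
    rw [Part.eq_some_iff.2 (kA.1 rfl),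
      Part.eq_some_iff.2 (kB.2 (by simp) _ (Part.mem_some _))]
    simp [Seq.seq]
  | succ n =>
    rw [Part.eq_some_iff.2 (kA.2 (by simp) (p n) (by simp)),
      Part.eq_some_iff.2 (kB.1 (by simp))]
    simp [Seq.seq, Baire.cons]

end BaireComputable

namespace MultiFun

theorem WeihrauchReducible.refl (f : MultiFun) : WeihrauchReducible f f := by
  refine ⟨_, _, BaireComputable.snd, BaireComputable.id, fun G hG => ?_⟩
  have : transform (fun p => Part.some p.snd) (fun p => Part.some p) G = G := by
    funext p; simp [transform]
  rwa [this]

theorem WeihrauchReducible.trans {f g h : MultiFun} (hfg : WeihrauchReducible f g)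
    (hgh : WeihrauchReducible g h) : WeihrauchReducible f h := by
  obtain ⟨K, H, hK, hH, e⟩ := hfg
  obtain ⟨K', H', hK', hH', e'⟩ := hgh
  refine ⟨_, _, hK.comp (BaireComputable.fst.pair
    (hK'.comp ((hH.comp BaireComputable.fst).pair BaireComputable.snd))), hH'.comp hH,
    fun G hG => ?_⟩
  have key := e _ (e' G hG)
  intro p x hx hd
  obtain ⟨q, hq, hy⟩ := key p x hx hd
  refine ⟨q, ?_, hy⟩
  obtain ⟨u, hu, v, hv, hq⟩ := mem_transform.1 hq
  obtain ⟨u', hu', v', hv', hv⟩ := mem_transform.1 hv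
  refine mem_transform.2 ⟨u', Part.mem_bind hu hu', v', hv', Part.mem_bind ?_ hq⟩
  simp only [Baire.fst_pair, Baire.snd_pair, Part.bind_some]
  exact Part.mem_bind (Part.mem_bind (Part.mem_bind (Part.mem_bind (Part.mem_some _) hu)
    (Part.mem_some _)) hv) (Part.mem_some _)

theorem meet_left (f g : MultiFun) : WeihrauchReducible (f.meet g) f := by
  refine ⟨_, _, (BaireComputable.cons 0).comp BaireComputable.snd, BaireComputable.fst,
    fun G hG p x hx hd => ?_⟩
  obtain ⟨ha, hb⟩ := RepresentedSpace.mem_prod_rep.1 hx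
  obtain ⟨-, h1, h2, -⟩ := hd
  obtain ⟨q, hq, y, hy, hyf⟩ := hG _ _ ha h1
  refine ⟨Baire.cons 0 q, ?_, Sum.inl y, RepresentedSpace.mem_coprod_rep_inl.2 ⟨rfl, hy⟩, h1, h2,
    Or.inl ⟨y, hyf, rfl⟩⟩
  exact mem_transform.2 ⟨_, Part.mem_some _, q, hq, by simp⟩

theorem meet_right (f g : MultiFun) : WeihrauchReducible (f.meet g) g := by
  refine ⟨_, _, (BaireComputable.cons 1).comp BaireComputable.snd, BaireComputable.snd,
    fun G hG p x hx hd => ?_⟩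
  obtain ⟨ha, hb⟩ := RepresentedSpace.mem_prod_rep.1 hx
  obtain ⟨-, h1, h2, -⟩ := hd
  obtain ⟨q, hq, y, hy, hyf⟩ := hG _ _ hb h2
  refine ⟨Baire.cons 1 q, ?_, Sum.inr y, RepresentedSpace.mem_coprod_rep_inr.2 ⟨rfl, hy⟩, h1, h2,
    Or.inr ⟨y, hyf, rfl⟩⟩
  exact mem_transform.2 ⟨_, Part.mem_some _, q, hq, by simp⟩

/-- Every multi-valued function has a realizer (by the axiom of choice). -/
theorem exists_realizes (f : MultiFun) : ∃ G, Realizes G f := by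
  classical
  have h : ∀ p : Baire, ∃ q : Baire, ∀ x ∈ f.source.rep p, x ∈ f.dom →
      ∃ y ∈ f.target.rep q, y ∈ f.val x := by
    intro p
    by_cases hp : ∃ x ∈ f.source.rep p, x ∈ f.dom
    · obtain ⟨x, hx, y, hy⟩ := hp
      obtain ⟨q, hq⟩ := f.target.surj y
      refine ⟨q, fun x' hx' _ => ⟨y, hq, ?_⟩⟩
      rwa [Part.mem_unique hx' hx]
    · exact ⟨p, fun x hx hd => (hp ⟨x, hx, hd⟩).elim⟩
  choose q hq using h
  exact ⟨fun p => Part.some (q p), fun p x hx hd => ⟨q p, Part.mem_some _, hq p x hx hd⟩⟩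

theorem le_meet {f g h : MultiFun} (hf : WeihrauchReducible h f)
    (hg : WeihrauchReducible h g) : WeihrauchReducible h (f.meet g) := by
  obtain ⟨K, H, hK, hH, e⟩ := hf
  obtain ⟨K', H', hK', hH', e'⟩ := hg
  have hsw : BaireComputable fun r => Part.some (Baire.pair r.fst r.snd.tail) := by
    simpa using BaireComputable.fst.pair (BaireComputable.tail.comp BaireComputable.snd)
  have hcond : BaireComputable fun r : Baire =>
      if r.snd 0 = 0 then K (Baire.pair r.fst r.snd.tail)
      else K' (Baire.pair r.fst r.snd.tail) := by
    have hb : ∀ (L : Baire →. Baire) (w : Baire), (Part.some w).bind L = L w :=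
      fun L w => Part.bind_some w L
    simpa only [hb] using (hK.comp hsw).cond (hK'.comp hsw)
  refine ⟨_, _, hcond, hH.pair hH', fun G hG p x hx hd => ?_⟩
  have dH : ∃ u ∈ H p, ∃ a ∈ f.source.rep u, a ∈ f.dom := by
    by_contra hn
    obtain ⟨G₀, hG₀⟩ := f.exists_realizes
    have hr : Realizes (fun u => ⟨(G₀ u).Dom ∧ ∃ a ∈ f.source.rep u, a ∈ f.dom,
        fun hu => (G₀ u).get hu.1⟩) f := by
      intro u a ha had
      obtain ⟨q, ⟨hqd, hqe⟩, hy⟩ := hG₀ u a ha had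
      exact ⟨q, ⟨⟨hqd, a, ha, had⟩, hqe⟩, hy⟩
    obtain ⟨q, hq, -⟩ := e _ hr p x hx hd
    obtain ⟨u, hu, v, ⟨⟨-, hv⟩, -⟩, -⟩ := mem_transform.1 hq
    exact hn ⟨u, hu, hv⟩
  have dH' : ∃ u ∈ H' p, ∃ a ∈ g.source.rep u, a ∈ g.dom := by
    by_contra hn
    obtain ⟨G₀, hG₀⟩ := g.exists_realizes
    have hr : Realizes (fun u => ⟨(G₀ u).Dom ∧ ∃ a ∈ g.source.rep u, a ∈ g.dom,
        fun hu => (G₀ u).get hu.1⟩) g := by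
      intro u a ha had
      obtain ⟨q, ⟨hqd, hqe⟩, hy⟩ := hG₀ u a ha had
      exact ⟨q, ⟨⟨hqd, a, ha, had⟩, hqe⟩, hy⟩
    obtain ⟨q, hq, -⟩ := e' _ hr p x hx hd
    obtain ⟨u, hu, v, ⟨⟨-, hv⟩, -⟩, -⟩ := mem_transform.1 hq
    exact hn ⟨u, hu, hv⟩
  obtain ⟨u, hu, a, ha, had⟩ := dH
  obtain ⟨u', hu', b, hb, hbd⟩ := dH'
  have hab : (a, b) ∈ (f.meet g).source.rep (Baire.pair u u') := by
    refine RepresentedSpace.mem_prod_rep.2 ?_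
    rw [Baire.fst_pair, Baire.snd_pair]
    exact ⟨ha, hb⟩
  have habd : (a, b) ∈ (f.meet g).dom := by
    obtain ⟨y, hy⟩ := id had
    exact ⟨Sum.inl y, had, hbd, Or.inl ⟨y, hy, rfl⟩⟩
  obtain ⟨q, hq, z, hz, -, -, hzv⟩ := hG _ _ hab habd
  have step : ∀ (L M : Baire →. Baire) (k : MultiFun) (w : Baire) (c : k.source.carrier)
      (y : k.target.carrier) (s : Baire), (∀ G, Realizes G k → Realizes (transform L M G) h) →
      w ∈ M p → c ∈ k.source.rep w → y ∈ k.target.rep s → y ∈ k.val c →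
      ∃ t ∈ L (Baire.pair p s), ∃ y' ∈ h.target.rep t, y' ∈ h.val x := by
    classical
    intro L M k w c y s he hw hc hy hyc
    obtain ⟨G₀, hG₀⟩ := k.exists_realizes
    have hr : Realizes (fun v => if v = w then Part.some s else G₀ v) k := by
      intro v a' ha' had'
      by_cases hv : v = w
      · subst hv
        rw [Part.mem_unique ha' hc]
        exact ⟨s, by simp, y, hy, hyc⟩
      · simpa [hv] using hG₀ v a' ha' had'
    obtain ⟨t, ht, hy'⟩ := he _ hr p x hx hd
    refine ⟨t, ?_, hy'⟩
    obtain ⟨w', hw', v, hv, ht⟩ := mem_transform.1 ht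
    rw [Part.mem_unique hw' hw, if_pos rfl, Part.mem_some_iff] at hv
    rwa [hv] at ht
  have fin : ∀ t, t ∈ (if q 0 = 0 then K (Baire.pair p q.tail) else K' (Baire.pair p q.tail)) →
      t ∈ transform (fun r : Baire => if r.snd 0 = 0 then K (Baire.pair r.fst r.snd.tail)
        else K' (Baire.pair r.fst r.snd.tail)) (fun p => (H p).bind fun u => (H' p).bind fun v =>
          Part.some (Baire.pair u v)) G p := by
    intro t ht
    refine mem_transform.2 ⟨_, Part.mem_bind hu (Part.mem_bind hu' (Part.mem_some _)), q, hq, ?_⟩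
    simpa only [Baire.fst_pair, Baire.snd_pair] using ht
  rcases hzv with ⟨y, hy, rfl⟩ | ⟨y, hy, rfl⟩
  · obtain ⟨h0, hz⟩ := RepresentedSpace.mem_coprod_rep_inl.1 hz
    obtain ⟨t, ht, hres⟩ := step K H f u a y q.tail e hu ha hz hy
    exact ⟨t, fin t (by rwa [if_pos h0]), hres⟩
  · obtain ⟨h0, hz⟩ := RepresentedSpace.mem_coprod_rep_inr.1 hz
    obtain ⟨t, ht, hres⟩ := step K' H' g u' b y q.tail e' hu' hb hz hy
    exact ⟨t, fin t (by rwa [if_neg (by omega)]), hres⟩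

/-- Multi-valued functions, preordered by Weihrauch reducibility. -/
instance : Preorder MultiFun where
  le := WeihrauchReducible
  le_refl := WeihrauchReducible.refl
  le_trans _ _ _ := WeihrauchReducible.trans

end MultiFun

/-! ### Weihrauch degrees -/

/-- The degrees of multi-valued functions: equivalence classes for mutual Weihrauch reducibility,
with the induced partial order. -/
abbrev MultiFunDegree : Type 1 := Antisymmetrization MultiFun (· ≤ ·)

/-- The meet of degrees is induced by the meet of multi-valued functions. -/
instance : SemilatticeInf MultiFunDegree where
  inf := Quotient.map₂ MultiFun.meet fun f f' hf g g' hg =>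
    ⟨MultiFun.le_meet ((MultiFun.meet_left f g).trans hf.1) ((MultiFun.meet_right f g).trans hg.1),
      MultiFun.le_meet ((MultiFun.meet_left f' g').trans hf.2)
        ((MultiFun.meet_right f' g').trans hg.2)⟩
  inf_le_left := by rintro ⟨f⟩ ⟨g⟩; exact MultiFun.meet_left f g
  inf_le_right := by rintro ⟨f⟩ ⟨g⟩; exact MultiFun.meet_right f g
  le_inf := by rintro ⟨f⟩ ⟨g⟩ ⟨h⟩ h1 h2; exact MultiFun.le_meet h1 h2

/-- The Weihrauch degrees: the degrees of multi-valued functions and an additional top element,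
with `a ⊓ ∞ = ∞ ⊓ a = a`. -/
abbrev WeihrauchDegree : Type 1 := WithTop MultiFunDegree

namespace WeihrauchDegree

/-- The degree of a multi-valued function. -/
def of (f : MultiFun) : WeihrauchDegree :=
  ((toAntisymmetrization (· ≤ ·) f : MultiFunDegree) : WithTop MultiFunDegree)

/-- The degree `0` of the nowhere defined multi-valued function. -/
def zero : WeihrauchDegree := of MultiFun.nowhere

/-- The additional top degree `∞`. -/
def infty : WeihrauchDegree := ⊤

/-- A degree is `⊓`-irreducible if it is not the meet of two degrees both different from it. -/
def MeetIrreducible (a : WeihrauchDegree) : Prop :=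
  ∀ b c : WeihrauchDegree, a = b ⊓ c → a = b ∨ a = c

end WeihrauchDegree

/-! Irreducibility of `∞` is order theory, and that of `0` holds because the domain of a meet is the
product of the domains. Everything else follows from one construction: if `f` has nonempty domain,
there are problems `a` and `b`, neither reducible to `f`, with `a ⊓ b ≤ f`
(`exists_meet_le_of_dom_nonempty`). By distributivity, `f ⊔ a` and `f ⊔ b` then lie strictly above
`f` and have meet `f` (`join_meet_join_le`).

Non-reducibility is a counting argument. Fix a total realizer `G` of `f`. On a given input, all
pairs of computable functionals together produce only countably many sequences through `G`, so a
problem whose answers on one input avoid this set is not reducible to `f`.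

If the trivial problem is not reducible to `f`, it serves as `b`. For `a` take a function defined
only at a name `p` of a point of `dom f`, with a value out of reach from `p`. An instance of `a ⊓ b`
then contains `p`, which is a legitimate query to `f`, and the `b` side can be answered by anything.

If the trivial problem is reducible to `f`, it suffices that `a ⊓ b` be solvable computably. Give
each number `k` a single name so that, for `k < j`, the name of `j` is out of reach from that of
`k`. Let `a` ask for a larger number outside `S`, given one in `S`, and let `b` be the same for the
complement. Neither reduces to `f`, yet an instance of the meet supplies the names of an element and
a non-element of `S`, and the larger of the two solves one side. -/

/-! ### Countability of the computable functionals -/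

namespace PartrecFunctional

/-- The functionals with a program of depth at most `n`. -/
def stage : ℕ → Set (Baire → ℕ →. ℕ)
  | 0 => {fun _ _ => Part.some 0, fun _ n => Part.some (n + 1), fun _ n => Part.some n.unpair.1,
      fun _ n => Part.some n.unpair.2, fun p n => Part.some (p n)}
  | k + 1 => stage k ∪
      Set.image2 (fun Φ Ψ p n => Nat.pair <$> Φ p n <*> Ψ p n) (stage k) (stage k) ∪
      Set.image2 (fun Φ Ψ p n => Ψ p n >>= Φ p) (stage k) (stage k) ∪
      Set.image2 (fun Φ Ψ p m =>
        let (a, n) := Nat.unpair m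
        n.rec (Φ p a) fun y IH => do
          let i ← IH
          Ψ p (Nat.pair a (Nat.pair y i))) (stage k) (stage k) ∪
      (fun Φ p a => Nat.rfind fun n => (fun m => m = 0) <$> Φ p (Nat.pair a n)) '' stage k

theorem countable_stage (k : ℕ) : (stage k).Countable := by
  induction k with
  | zero => exact ((((Set.countable_singleton _).insert _).insert _).insert _).insert _
  | succ k ih =>
    exact ((((ih.union (ih.image2 ih _)).union (ih.image2 ih _)).union (ih.image2 ih _)).union
      (ih.image _))

theorem stage_mono : Monotone stage :=
  monotone_nat_of_le_succ fun _ _ h => Or.inl (Or.inl (Or.inl (Or.inl h)))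

theorem exists_mem_stage {Φ : Baire → ℕ →. ℕ} (hΦ : PartrecFunctional Φ) :
    ∃ k, Φ ∈ stage k := by
  induction hΦ with
  | zero => exact ⟨0, Or.inl rfl⟩
  | succ => exact ⟨0, Or.inr (Or.inl rfl)⟩
  | left => exact ⟨0, Or.inr (Or.inr (Or.inl rfl))⟩
  | right => exact ⟨0, Or.inr (Or.inr (Or.inr (Or.inl rfl)))⟩
  | oracle => exact ⟨0, Or.inr (Or.inr (Or.inr (Or.inr rfl)))⟩
  | pair _ _ h1 h2 =>
    obtain ⟨i, hi⟩ := h1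
    obtain ⟨j, hj⟩ := h2
    exact ⟨max i j + 1, Or.inl (Or.inl (Or.inl (Or.inr
      ⟨_, stage_mono (le_max_left i j) hi, _, stage_mono (le_max_right i j) hj, rfl⟩)))⟩
  | comp _ _ h1 h2 =>
    obtain ⟨i, hi⟩ := h1
    obtain ⟨j, hj⟩ := h2
    exact ⟨max i j + 1, Or.inl (Or.inl (Or.inr
      ⟨_, stage_mono (le_max_left i j) hi, _, stage_mono (le_max_right i j) hj, rfl⟩))⟩
  | prec _ _ h1 h2 =>
    obtain ⟨i, hi⟩ := h1
    obtain ⟨j, hj⟩ := h2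
    exact ⟨max i j + 1, Or.inl (Or.inr
      ⟨_, stage_mono (le_max_left i j) hi, _, stage_mono (le_max_right i j) hj, rfl⟩)⟩
  | rfind _ h1 =>
    obtain ⟨i, hi⟩ := h1
    exact ⟨i + 1, Or.inr ⟨_, hi, rfl⟩⟩

/-- No coding of programs is needed: finitely many basic functionals are closed under finitely many
operations of at most two arguments, so each stage is countable. -/
theorem countable_setOf : {Φ | PartrecFunctional Φ}.Countable :=
  (Set.countable_iUnion countable_stage).mono fun _ hΦ => Set.mem_iUnion.2 (exists_mem_stage hΦ)

open Classical in
/-- The sequence computed by `Φ` from `p`, with the value `0` where `Φ p` diverges. -/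
noncomputable def output (Φ : Baire → ℕ →. ℕ) (p : Baire) : Baire :=
  fun n => (Φ p n).getOrElse 0

theorem output_eq {Φ : Baire → ℕ →. ℕ} {p q : Baire} (h : ∀ n, q n ∈ Φ p n) :
    output Φ p = q := by
  funext n
  simp [output, Part.eq_some_iff.2 (h n)]

end PartrecFunctional

/-! ### Computable case distinctions, and uncountability of Baire space -/

namespace BaireComputable

theorem comp_total {F : Baire →. Baire} {S : Baire → Baire} (hF : BaireComputable F)
    (hS : BaireComputable fun p => Part.some (S p)) : BaireComputable fun p => F (S p) := by
  have h := hF.comp hS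
  have e : (fun p => (Part.some (S p)).bind F) = fun p => F (S p) :=
    funext fun p => Part.bind_some _ _
  rwa [e] at h

theorem pair_total {S T : Baire → Baire} (hS : BaireComputable fun p => Part.some (S p))
    (hT : BaireComputable fun p => Part.some (T p)) :
    BaireComputable fun p => Part.some (Baire.pair (S p) (T p)) := by
  simpa using hS.pair hT

/-- Case distinction on the first entry of a computable sequence. -/
theorem ite_apply_zero {F G : Baire →. Baire} {T : Baire → Baire}
    (hT : BaireComputable fun p => Part.some (T p)) (hF : BaireComputable F)
    (hG : BaireComputable G) : BaireComputable fun p => if T p 0 = 0 then F p else G p := by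
  -- `cond` inspects the second component, so `T p` is attached to `p` for the test and discarded in
  -- both branches.
  have h := ((hF.comp_total fst).cond (hG.comp_total fst)).comp_total (id.pair_total hT)
  simpa only [Baire.fst_pair, Baire.snd_pair] using h

end BaireComputable

namespace Baire

theorem cons_injective (k : ℕ) : Function.Injective (cons k) :=
  Function.LeftInverse.injective (g := tail) (tail_cons k)

theorem exists_notMem_of_countable {C : Set Baire} (hC : C.Countable) : ∃ q, q ∉ C := by
  by_contra! h
  have : Uncountable (ℕ → ℕ) := by
    rw [← Cardinal.aleph0_lt_mk_iff]
    simpa using Cardinal.cantor Cardinal.aleph0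
  exact Set.not_countable_univ (hC.mono fun q _ => h q)

end Baire

/-! ### Reductions in terms of names and answers -/

namespace MultiFun

/-- Weihrauch reducibility without realizers. -/
theorem le_iff {f g : MultiFun} : f ≤ g ↔ ∃ K H : Baire →. Baire,
    BaireComputable K ∧ BaireComputable H ∧ ∀ p, ∀ x ∈ f.source.rep p, x ∈ f.dom →
      ∃ u ∈ H p, ∃ z ∈ g.source.rep u, z ∈ g.dom ∧
        ∀ v, ∀ y ∈ g.target.rep v, y ∈ g.val z →
          ∃ q ∈ K (Baire.pair p v), ∃ y' ∈ f.target.rep q, y' ∈ f.val x := by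
  classical
  constructor
  · rintro ⟨K, H, hK, hH, e⟩
    refine ⟨K, H, hK, hH, fun p x hx hd => ?_⟩
    obtain ⟨G, hG⟩ := g.exists_realizes
    have dH : ∃ u ∈ H p, ∃ z ∈ g.source.rep u, z ∈ g.dom := by
      by_contra hn
      -- A realizer that diverges off the names of instances forces `H p` to be such a name.
      have hr : Realizes (fun u => if ∃ z ∈ g.source.rep u, z ∈ g.dom then G u else Part.none)
          g := by
        intro u z hz hzd
        have hu : ∃ z ∈ g.source.rep u, z ∈ g.dom := ⟨z, hz, hzd⟩
        simpa only [if_pos hu] using hG u z hz hzd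
      obtain ⟨q, hq, -⟩ := e _ hr p x hx hd
      obtain ⟨u, hu, v, hv, -⟩ := mem_transform.1 hq
      refine hn ⟨u, hu, ?_⟩
      by_contra hu'
      simp only [if_neg hu'] at hv
      exact Part.notMem_none _ hv
    obtain ⟨u, hu, z, hz, hzd⟩ := dH
    refine ⟨u, hu, z, hz, hzd, fun v y hy hyz => ?_⟩
    -- A realizer may be changed at the single name `u` to return any correct answer, so `K` has to
    -- cope with every `v`.
    have hr : Realizes (fun w => if w = u then Part.some v else G w) g := by
      intro w z' hz' hzd'
      by_cases hw : w = u
      · subst hw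
        rw [Part.mem_unique hz' hz]
        exact ⟨v, by simp, y, hy, hyz⟩
      · simpa [hw] using hG w z' hz' hzd'
    obtain ⟨q, hq, hy'⟩ := e _ hr p x hx hd
    refine ⟨q, ?_, hy'⟩
    obtain ⟨w, hw, v', hv', hq⟩ := mem_transform.1 hq
    rw [Part.mem_unique hw hu, if_pos rfl, Part.mem_some_iff] at hv'
    rwa [hv'] at hq
  · rintro ⟨K, H, hK, hH, e⟩
    refine ⟨K, H, hK, hH, fun G hG p x hx hd => ?_⟩
    obtain ⟨u, hu, z, hz, hzd, h⟩ := e p x hx hd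
    obtain ⟨v, hv, y, hy, hyz⟩ := hG u z hz hzd
    obtain ⟨q, hq, hy'⟩ := h v y hy hyz
    exact ⟨q, mem_transform.2 ⟨u, hu, v, hv, hq⟩, hy'⟩

/-! ### Joins -/

/-- The join `f ⊔ g : ⊆ X ⊔ U ⇉ Y ⊔ V` of two multi-valued functions. -/
def join (f g : MultiFun) : MultiFun where
  source := f.source.coprod g.source
  target := f.target.coprod g.target
  val := Sum.elim (fun x => Sum.inl '' f.val x) fun u => Sum.inr '' g.val u

theorem le_join_left (f g : MultiFun) : f ≤ f.join g := by
  refine le_iff.2 ⟨_, _, BaireComputable.tail.comp_total BaireComputable.snd,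
    BaireComputable.cons 0, fun p x hx hd => ⟨_, Part.mem_some _, Sum.inl x,
      RepresentedSpace.mem_coprod_rep_inl.2 ⟨rfl, hx⟩, hd.image _, ?_⟩⟩
  rintro v _ hv ⟨y, hy, rfl⟩
  refine ⟨_, Part.mem_some _, y, ?_, hy⟩
  rw [Baire.snd_pair]
  exact (RepresentedSpace.mem_coprod_rep_inl.1 hv).2

theorem le_join_right (f g : MultiFun) : g ≤ f.join g := by
  refine le_iff.2 ⟨_, _, BaireComputable.tail.comp_total BaireComputable.snd,
    BaireComputable.cons 1, fun p x hx hd => ⟨_, Part.mem_some _, Sum.inr x,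
      RepresentedSpace.mem_coprod_rep_inr.2 ⟨rfl, hx⟩, hd.image _, ?_⟩⟩
  rintro v _ hv ⟨y, hy, rfl⟩
  refine ⟨_, Part.mem_some _, y, ?_, hy⟩
  rw [Baire.snd_pair]
  exact (RepresentedSpace.mem_coprod_rep_inr.1 hv).2

/-- Post-processing which turns answers of `f i ⊓ c` into answers of `(f 0 ⊔ f 1) ⊓ c`. -/
def relabel (i : ℕ) : Baire →. Baire := fun r =>
  -- A first entry other than `0` marks an answer to `c`, which the join does not affect.
  if r 0 = 0 then Part.some (Baire.cons 0 (Baire.cons i r.tail)) else Part.some r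

theorem baireComputable_relabel (i : ℕ) : BaireComputable (relabel i) :=
  BaireComputable.id.ite_apply_zero
    (((BaireComputable.cons 0).comp_total (BaireComputable.cons i)).comp_total
      BaireComputable.tail) BaireComputable.id

theorem relabel_inl {f g c : MultiFun} {x : f.source.carrier} {u : c.source.carrier} {q : Baire}
    {y : (f.meet c).target.carrier} (hq : y ∈ (f.meet c).target.rep q)
    (hy : y ∈ (f.meet c).val (x, u)) :
    ∃ q' ∈ relabel 0 q, ∃ y' ∈ ((f.join g).meet c).target.rep q',
      y' ∈ ((f.join g).meet c).val (Sum.inl x, u) := by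
  obtain ⟨hx, hu, ⟨y, hy, rfl⟩ | ⟨y, hy, rfl⟩⟩ := hy
  · obtain ⟨h0, hq⟩ := RepresentedSpace.mem_coprod_rep_inl.1 hq
    refine ⟨Baire.cons 0 (Baire.cons 0 q.tail), by simp [relabel, h0], Sum.inl (Sum.inl y),
      RepresentedSpace.mem_coprod_rep_inl.2 ⟨rfl, RepresentedSpace.mem_coprod_rep_inl.2
        ⟨rfl, hq⟩⟩, hx.image _, hu, Or.inl ⟨_, ⟨y, hy, rfl⟩, rfl⟩⟩
  · obtain ⟨h0, hq⟩ := RepresentedSpace.mem_coprod_rep_inr.1 hq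
    refine ⟨q, by simp [relabel, h0], Sum.inr y,
      RepresentedSpace.mem_coprod_rep_inr.2 ⟨h0, hq⟩, hx.image _, hu, Or.inr ⟨y, hy, rfl⟩⟩

theorem relabel_inr {f g c : MultiFun} {x : g.source.carrier} {u : c.source.carrier} {q : Baire}
    {y : (g.meet c).target.carrier} (hq : y ∈ (g.meet c).target.rep q)
    (hy : y ∈ (g.meet c).val (x, u)) :
    ∃ q' ∈ relabel 1 q, ∃ y' ∈ ((f.join g).meet c).target.rep q',
      y' ∈ ((f.join g).meet c).val (Sum.inr x, u) := by
  obtain ⟨hx, hu, ⟨y, hy, rfl⟩ | ⟨y, hy, rfl⟩⟩ := hy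
  · obtain ⟨h0, hq⟩ := RepresentedSpace.mem_coprod_rep_inl.1 hq
    refine ⟨Baire.cons 0 (Baire.cons 1 q.tail), by simp [relabel, h0], Sum.inl (Sum.inr y),
      RepresentedSpace.mem_coprod_rep_inl.2 ⟨rfl, RepresentedSpace.mem_coprod_rep_inr.2
        ⟨rfl, hq⟩⟩, hx.image _, hu, Or.inl ⟨_, ⟨y, hy, rfl⟩, rfl⟩⟩
  · obtain ⟨h0, hq⟩ := RepresentedSpace.mem_coprod_rep_inr.1 hq
    refine ⟨q, by simp [relabel, h0], Sum.inr y,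
      RepresentedSpace.mem_coprod_rep_inr.2 ⟨h0, hq⟩, hx.image _, hu, Or.inr ⟨y, hy, rfl⟩⟩

theorem mem_meet_dom {f g : MultiFun} {x : f.source.carrier} {u : g.source.carrier} :
    (x, u) ∈ (f.meet g).dom ↔ x ∈ f.dom ∧ u ∈ g.dom := by
  refine ⟨fun ⟨_, h1, h2, _⟩ => ⟨h1, h2⟩, fun ⟨h1, h2⟩ => ?_⟩
  obtain ⟨y, hy⟩ := id h1
  exact ⟨Sum.inl y, h1, h2, Or.inl ⟨y, hy, rfl⟩⟩

/-- The nontrivial half of distributivity. The tag at the front of the name of the point of the join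
is readable from the input, so both halves of the reduction can choose the given reduction that
applies. -/
theorem join_meet_le {f g c h : MultiFun} (hf : f.meet c ≤ h) (hg : g.meet c ≤ h) :
    (f.join g).meet c ≤ h := by
  obtain ⟨K, H, hK, hH, e⟩ := le_iff.1 hf
  obtain ⟨K', H', hK', hH', e'⟩ := le_iff.1 hg
  have hin : BaireComputable fun p : Baire => Part.some (Baire.pair p.fst.tail p.snd) :=
    (BaireComputable.tail.comp_total BaireComputable.fst).pair_total BaireComputable.snd
  -- The post-processing sees the original input beside the answer; the tag must be stripped there
  -- too before `K` or `K'` is applied.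
  have hin' : BaireComputable fun r : Baire =>
      Part.some (Baire.pair (Baire.pair r.fst.fst.tail r.fst.snd) r.snd) :=
    (hin.comp_total BaireComputable.fst).pair_total BaireComputable.snd
  refine le_iff.2 ⟨_, _,
    (BaireComputable.fst.comp_total BaireComputable.fst).ite_apply_zero
      (((baireComputable_relabel 0).comp hK).comp_total hin')
      (((baireComputable_relabel 1).comp hK').comp_total hin'),
    BaireComputable.fst.ite_apply_zero (hH.comp_total hin) (hH'.comp_total hin), ?_⟩
  rintro p ⟨x | x, w⟩ hx hd
  · obtain ⟨hx, hw⟩ := RepresentedSpace.mem_prod_rep.1 hx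
    obtain ⟨h0, hx⟩ := RepresentedSpace.mem_coprod_rep_inl.1 hx
    obtain ⟨hxd, hwd⟩ := mem_meet_dom.1 hd
    obtain ⟨u, hu, z, hz, hzd, hr⟩ := e (Baire.pair p.fst.tail p.snd) (x, w)
      (RepresentedSpace.mem_prod_rep.2 ⟨by simpa using hx, by simpa using hw⟩)
      (mem_meet_dom.2 ⟨Set.image_nonempty.1 hxd, hwd⟩)
    refine ⟨u, by simpa only [if_pos h0] using hu, z, hz, hzd, fun v y hy hyz => ?_⟩
    obtain ⟨q, hq, y', hy', hy'x⟩ := hr v y hy hyz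
    obtain ⟨q', hq', hres⟩ := relabel_inl (g := g) hy' hy'x
    refine ⟨q', ?_, hres⟩
    simp only [Baire.fst_pair, Baire.snd_pair, if_pos h0]
    exact Part.mem_bind hq hq'
  · obtain ⟨hx, hw⟩ := RepresentedSpace.mem_prod_rep.1 hx
    obtain ⟨h0, hx⟩ := RepresentedSpace.mem_coprod_rep_inr.1 hx
    obtain ⟨hxd, hwd⟩ := mem_meet_dom.1 hd
    obtain ⟨u, hu, z, hz, hzd, hr⟩ := e' (Baire.pair p.fst.tail p.snd) (x, w)
      (RepresentedSpace.mem_prod_rep.2 ⟨by simpa using hx, by simpa using hw⟩)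
      (mem_meet_dom.2 ⟨Set.image_nonempty.1 hxd, hwd⟩)
    have h0' : ¬ p.fst 0 = 0 := by omega
    refine ⟨u, by simpa only [if_neg h0'] using hu, z, hz, hzd, fun v y hy hyz => ?_⟩
    obtain ⟨q, hq, y', hy', hy'x⟩ := hr v y hy hyz
    obtain ⟨q', hq', hres⟩ := relabel_inr (f := f) hy' hy'x
    refine ⟨q', ?_, hres⟩
    simp only [Baire.fst_pair, Baire.snd_pair, if_neg h0']
    exact Part.mem_bind hq hq'

theorem meet_comm_le (f g : MultiFun) : f.meet g ≤ g.meet f :=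
  le_meet (meet_right f g) (meet_left f g)

/-- Expanding both joins by distributivity leaves four meets; three contain `f` as a factor and the
fourth is `a ⊓ b`. -/
theorem join_meet_join_le {f a b : MultiFun} (h : a.meet b ≤ f) :
    (f.join a).meet (f.join b) ≤ f :=
  join_meet_le (meet_left _ _) ((meet_comm_le _ _).trans
    (join_meet_le (meet_left _ _) ((meet_comm_le _ _).trans h)))

/-! ### Functions which are not reducible to a given one -/

/-- The sequences that some Weihrauch reduction to a problem with realizer `G` produces on the
input `p`. -/
def reachable (G : Baire → Baire) (p : Baire) : Set Baire :=
  Set.image2 (fun Φ Ψ => PartrecFunctional.output Φ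
    (Baire.pair p (G (PartrecFunctional.output Ψ p)))) {Φ | PartrecFunctional Φ}
    {Ψ | PartrecFunctional Ψ}

theorem countable_reachable (G : Baire → Baire) (p : Baire) : (reachable G p).Countable :=
  PartrecFunctional.countable_setOf.image2 PartrecFunctional.countable_setOf _

theorem exists_realizes_total (f : MultiFun) :
    ∃ G : Baire → Baire, Realizes (fun p => Part.some (G p)) f := by
  classical
  obtain ⟨G, hG⟩ := f.exists_realizes
  -- The default is never used at a name of a point of the domain, where `G` is defined.
  refine ⟨fun p => (G p).getOrElse p, fun p x hx hd => ?_⟩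
  obtain ⟨q, hq, h⟩ := hG p x hx hd
  exact ⟨q, by simp [Part.eq_some_iff.2 hq], h⟩

/-- On the inputs that matter, `K` and `H` agree with the outputs of their functionals, and `G`
supplies a correct answer to the query. -/
theorem exists_mem_reachable_of_le {f g : MultiFun} (hfg : f ≤ g) {G : Baire → Baire}
    (hG : Realizes (fun p => Part.some (G p)) g) {p : Baire} {x : f.source.carrier}
    (hx : x ∈ f.source.rep p) (hd : x ∈ f.dom) :
    ∃ q ∈ reachable G p, ∃ y ∈ f.target.rep q, y ∈ f.val x := by
  obtain ⟨K, H, ⟨Φ, hΦ, eΦ⟩, ⟨Ψ, hΨ, eΨ⟩, e⟩ := le_iff.1 hfg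
  obtain ⟨u, hu, z, hz, hzd, hr⟩ := e p x hx hd
  obtain ⟨v, hv, y, hy, hyz⟩ := hG u z hz hzd
  rw [Part.mem_some_iff] at hv
  subst hv
  obtain ⟨q, hq, hres⟩ := hr _ y hy hyz
  refine ⟨q, ⟨Φ, hΦ, Ψ, hΨ, ?_⟩, hres⟩
  dsimp only
  rw [PartrecFunctional.output_eq (eΨ p u hu), PartrecFunctional.output_eq (eΦ _ q hq)]

/-- The trivial problem: every input is allowed, and every answer is correct. -/
def trivial : MultiFun where
  source := .baire
  target := .baire
  val := fun _ => Set.univ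

/-- The partial single-valued function with the graph `{(p, q)}`. -/
def single (p q : Baire) : MultiFun where
  source := .baire
  target := .baire
  val := fun x => {y | x = p ∧ y = q}

theorem single_not_le {f : MultiFun} {G : Baire → Baire}
    (hG : Realizes (fun p => Part.some (G p)) f) {p q : Baire} (hq : q ∉ reachable G p) :
    ¬ single p q ≤ f := by
  intro h
  obtain ⟨r, hr, y, hy, -, hyq⟩ := exists_mem_reachable_of_le h hG (p := p) (x := p)
    (Part.mem_some _) ⟨q, rfl, rfl⟩
  rw [← Part.mem_some_iff.1 hy, hyq] at hr
  exact hq hr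

/-- The only admissible first component is `p`, itself a name of a point of `dom f`. It is passed on
as the query, and the trivial side is answered whatever `f` returns. -/
theorem single_meet_trivial_le {f : MultiFun} {p q : Baire} {x : f.source.carrier}
    (hx : x ∈ f.source.rep p) (hd : x ∈ f.dom) : (single p q).meet trivial ≤ f := by
  refine le_iff.2 ⟨_, _, BaireComputable.cons 1, BaireComputable.fst, ?_⟩
  rintro r ⟨a, b⟩ hr hrd
  obtain ⟨ha, hb⟩ := RepresentedSpace.mem_prod_rep.1 hr
  obtain ⟨had, hbd⟩ := mem_meet_dom.1 hrd
  obtain ⟨-, hap, -⟩ := id had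
  refine ⟨r.fst, Part.mem_some _, x, ?_, hd, fun v y hy hyx => ?_⟩
  · rwa [← Part.mem_some_iff.1 ha, hap]
  · exact ⟨_, Part.mem_some _, Sum.inr (Baire.pair r v),
      RepresentedSpace.mem_coprod_rep_inr.2 ⟨rfl, Part.mem_some _⟩, had, hbd,
      Or.inr ⟨_, Set.mem_univ _, rfl⟩⟩

end MultiFun

/-! ### Numbers with mutually unreachable names -/

/-- The natural numbers, where the only name of `k` is `u k` with `k` put in front. -/
def RepresentedSpace.tagged (u : ℕ → Baire) : RepresentedSpace where
  carrier := ℕ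
  rep := fun p => ⟨p.tail = u (p 0), fun _ => p 0⟩
  surj := fun k => ⟨Baire.cons k (u k), rfl, rfl⟩

theorem RepresentedSpace.mem_tagged_rep {u : ℕ → Baire} {p : Baire} {k : ℕ} :
    k ∈ (tagged u).rep p ↔ p = Baire.cons k (u k) := by
  constructor
  · rintro ⟨h, rfl⟩
    funext n
    cases n with
    | zero => rfl
    | succ n => exact congrFun h n
  · rintro rfl
    exact ⟨rfl, rfl⟩

namespace MultiFun

/-- Given an element of `S`, find a larger number outside of `S`. -/
def larger (u : ℕ → Baire) (S : Set ℕ) : MultiFun where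
  source := .tagged u
  target := .tagged u
  val := fun (k : ℕ) => {j : ℕ | k ∈ S ∧ j ∉ S ∧ k < j}

/-- Every correct answer at `k` is some `y > k`, whose only name is out of reach. The number `j`
merely witnesses that `k` lies in the domain. -/
theorem larger_not_le {f : MultiFun} {G : Baire → Baire}
    (hG : Realizes (fun p => Part.some (G p)) f) {u : ℕ → Baire}
    (hu : ∀ k j, k < j → Baire.cons j (u j) ∉ reachable G (Baire.cons k (u k))) {S : Set ℕ}
    {k j : ℕ} (hk : k ∈ S) (hj : j ∉ S) (hkj : k < j) : ¬ larger u S ≤ f := by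
  intro h
  obtain ⟨q, hq, y, hy, -, -, hky⟩ := exists_mem_reachable_of_le h hG
    (RepresentedSpace.mem_tagged_rep.2 rfl) (x := k) ⟨j, hk, hj, hkj⟩
  rw [RepresentedSpace.mem_tagged_rep.1 hy] at hq
  exact hu k y hky hq

/-- An instance consists of names of some `k ∈ S` and `j ∉ S`, which are distinct. Comparing them is
computable, and the name of the larger one, already part of the input, solves the corresponding
side. -/
theorem larger_meet_larger_compl_le (u : ℕ → Baire) (S : Set ℕ) :
    (larger u S).meet (larger u Sᶜ) ≤ trivial := by
  -- At entry `0` this is the truncated difference `k + 1 - j`, which vanishes exactly when `k < j`.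
  have hT : BaireComputable fun r : Baire =>
      Part.some fun n => (r.fst n).unpair.1 + 1 - (r.fst n).unpair.2 := by
    have hf : Primrec fun n : ℕ => n.unpair.1 + 1 - n.unpair.2 :=
      Primrec.nat_sub.comp (Primrec.succ.comp (Primrec.fst.comp Primrec.unpair))
        (Primrec.snd.comp Primrec.unpair)
    exact (BaireComputable.map hf).comp_total BaireComputable.fst
  refine le_iff.2 ⟨_, _, hT.ite_apply_zero
    ((BaireComputable.cons 0).comp_total (BaireComputable.snd.comp_total BaireComputable.fst))
    ((BaireComputable.cons 1).comp_total (BaireComputable.fst.comp_total BaireComputable.fst)),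
    BaireComputable.id, ?_⟩
  rintro r ⟨(k : ℕ), (j : ℕ)⟩ hr hd
  obtain ⟨hk, hj⟩ := RepresentedSpace.mem_prod_rep.1 hr
  obtain ⟨hkd, hjd⟩ := mem_meet_dom.1 hd
  obtain ⟨-, hkS, -⟩ := id hkd
  obtain ⟨-, hjS, -⟩ := id hjd
  refine ⟨r, Part.mem_some _, r, Part.mem_some _, ⟨r, Set.mem_univ _⟩, fun v y hy hyr => ?_⟩
  have hk0 : (r 0).unpair.1 = k := congrFun (RepresentedSpace.mem_tagged_rep.1 hk) 0
  have hj0 : (r 0).unpair.2 = j := congrFun (RepresentedSpace.mem_tagged_rep.1 hj) 0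
  simp only [Baire.fst_pair, hk0, hj0]
  change k ∈ S at hkS
  change j ∉ S at hjS
  have hne : k ≠ j := fun h => hjS (h ▸ hkS)
  by_cases hkj : k < j
  · rw [if_pos (by omega)]
    exact ⟨_, Part.mem_some _, Sum.inl j, RepresentedSpace.mem_coprod_rep_inl.2 ⟨rfl, hj⟩,
      hkd, hjd, Or.inl ⟨j, ⟨hkS, hjS, hkj⟩, rfl⟩⟩
  · rw [if_neg (by omega)]
    exact ⟨_, Part.mem_some _, Sum.inr k, RepresentedSpace.mem_coprod_rep_inr.2 ⟨rfl, hk⟩,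
      hkd, hjd, Or.inr ⟨k, ⟨hjS, not_not.2 hkS, by omega⟩, rfl⟩⟩

/-- Choose the sequences recursively; each has to avoid only countably many values determined by its
finitely many predecessors. -/
theorem exists_seq_notMem_reachable (G : Baire → Baire) : ∃ u : ℕ → Baire, ∀ k j, k < j →
    Baire.cons j (u j) ∉ reachable G (Baire.cons k (u k)) := by
  obtain ⟨u, -, hu⟩ := exists_seq_of_forall_finset_exists (fun _ : Baire => True)
    (fun p q => ∀ k j, Baire.cons j q ∉ reachable G (Baire.cons k p)) fun s _ => by
      -- The recursion does not reveal the indices of the sequences, so all tags `k` and `j` are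
      -- avoided at once.
      have hC : (⋃ p ∈ s, ⋃ k, ⋃ j,
          Baire.cons j ⁻¹' reachable G (Baire.cons k p)).Countable :=
        s.countable_toSet.biUnion fun p _ => Set.countable_iUnion fun k =>
          Set.countable_iUnion fun j =>
            (countable_reachable G _).preimage (Baire.cons_injective j)
      obtain ⟨q, hq⟩ := Baire.exists_notMem_of_countable hC
      simp only [Set.mem_iUnion, not_exists] at hq
      exact ⟨q, True.intro, fun p hp k j => hq p hp k j⟩
  exact ⟨u, fun k j hkj => hu k j hkj k j⟩

/-- The case distinction is whether `dom f` contains a point with a computable name, which is what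
`trivial ≤ f` amounts to. -/
theorem exists_meet_le_of_dom_nonempty {f : MultiFun} (hf : f.dom.Nonempty) :
    ∃ a b : MultiFun, ¬ a ≤ f ∧ ¬ b ≤ f ∧ a.meet b ≤ f := by
  obtain ⟨G, hG⟩ := f.exists_realizes_total
  by_cases ht : trivial ≤ f
  · obtain ⟨u, hu⟩ := exists_seq_notMem_reachable G
    -- Any set works if it has an element below a non-element and a non-element below an element;
    -- for the even numbers, `0 < 1` and `1 < 2`.
    refine ⟨larger u {k | Even k}, larger u {k | Even k}ᶜ,
      larger_not_le hG hu (k := 0) (j := 1) ?_ ?_ one_pos,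
      larger_not_le hG hu (k := 1) (j := 2) ?_ ?_ one_lt_two,
      (larger_meet_larger_compl_le u _).trans ht⟩ <;> simp
  · obtain ⟨x, hx⟩ := hf
    obtain ⟨p, hp⟩ := f.source.surj x
    obtain ⟨q, hq⟩ := Baire.exists_notMem_of_countable (countable_reachable G p)
    exact ⟨single p q, trivial, single_not_le hG hq, ht, single_meet_trivial_le hp hx⟩

theorem le_of_dom_eq_empty {f : MultiFun} (hf : f.dom = ∅) (g : MultiFun) : f ≤ g :=
  le_iff.2 ⟨_, _, BaireComputable.id, BaireComputable.id, fun p x _ hd => by simp [hf] at hd⟩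

theorem dom_eq_empty_of_le_nowhere {f : MultiFun} (hf : f ≤ nowhere) : f.dom = ∅ := by
  obtain ⟨K, H, -, -, e⟩ := le_iff.1 hf
  refine Set.eq_empty_of_forall_notMem fun x hx => ?_
  obtain ⟨p, hp⟩ := f.source.surj x
  obtain ⟨u, -, z, -, ⟨y, hy⟩, -⟩ := e p x hp hx
  exact hy

end MultiFun

/-! ### Passage to degrees -/

namespace WeihrauchDegree

theorem of_le_of {f g : MultiFun} : of f ≤ of g ↔ f ≤ g := by
  rw [of, of, WithTop.coe_le_coe, toAntisymmetrization_le_toAntisymmetrization_iff]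

theorem of_inf_of (f g : MultiFun) : of f ⊓ of g = of (f.meet g) := rfl

theorem eq_infty_or_exists_of (a : WeihrauchDegree) : a = infty ∨ ∃ f, a = of f := by
  induction a with
  | none => exact Or.inl rfl
  | some a =>
    induction a using Quotient.inductionOn with
    | h f => exact Or.inr ⟨f, rfl⟩

theorem of_eq_zero_iff {f : MultiFun} : of f = zero ↔ f.dom = ∅ := by
  refine ⟨fun h => MultiFun.dom_eq_empty_of_le_nowhere (of_le_of.1 h.le), fun h => ?_⟩
  have hn : MultiFun.nowhere.dom = ∅ := MultiFun.dom_eq_empty_of_le_nowhere le_rfl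
  exact le_antisymm (of_le_of.2 (MultiFun.le_of_dom_eq_empty h _))
    (of_le_of.2 (MultiFun.le_of_dom_eq_empty hn _))

theorem exists_lt_lt_eq_inf {a : WeihrauchDegree} (h0 : a ≠ zero) (h1 : a ≠ infty) :
    ∃ b c : WeihrauchDegree, a < b ∧ a < c ∧ a = b ⊓ c := by
  obtain rfl | ⟨f, rfl⟩ := a.eq_infty_or_exists_of
  · exact absurd rfl h1
  obtain ⟨g, h, hg, hh, hgh⟩ := MultiFun.exists_meet_le_of_dom_nonempty
    (Set.nonempty_iff_ne_empty.2 (mt of_eq_zero_iff.2 h0))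
  refine ⟨of (f.join g), of (f.join h), ?_, ?_, ?_⟩
  · exact lt_of_le_not_ge (of_le_of.2 (MultiFun.le_join_left f g)) fun hle =>
      hg ((MultiFun.le_join_right f g).trans (of_le_of.1 hle))
  · exact lt_of_le_not_ge (of_le_of.2 (MultiFun.le_join_left f h)) fun hle =>
      hh ((MultiFun.le_join_right f h).trans (of_le_of.1 hle))
  · rw [of_inf_of]
    exact le_antisymm (of_le_of.2 (MultiFun.le_meet (MultiFun.le_join_left f g)
      (MultiFun.le_join_left f h))) (of_le_of.2 (MultiFun.join_meet_join_le hgh))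

theorem meetIrreducible_infty : infty.MeetIrreducible := fun _ _ h =>
  Or.inl (inf_eq_top_iff.1 h.symm).1.symm

/-- A product of two nonempty domains is nonempty, so a meet of nonzero degrees is nonzero. -/
theorem meetIrreducible_zero : zero.MeetIrreducible := by
  intro b c h
  obtain rfl | ⟨f, rfl⟩ := b.eq_infty_or_exists_of
  · exact Or.inr (h.trans (top_inf_eq c))
  obtain rfl | ⟨g, rfl⟩ := c.eq_infty_or_exists_of
  · exact Or.inl (h.trans (inf_top_eq _))
  rw [of_inf_of] at h
  have hd := of_eq_zero_iff.1 h.symm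
  by_contra! hn
  obtain ⟨x, hx⟩ := Set.nonempty_iff_ne_empty.2 (mt of_eq_zero_iff.2 hn.1.symm)
  obtain ⟨y, hy⟩ := Set.nonempty_iff_ne_empty.2 (mt of_eq_zero_iff.2 hn.2.symm)
  exact (hd ▸ MultiFun.mem_meet_dom.2 ⟨hx, hy⟩ : (x, y) ∈ (∅ : Set _))

end WeihrauchDegree

theorem theorem65 :
    (∀ a : WeihrauchDegree,
      a.MeetIrreducible ↔ a = WeihrauchDegree.zero ∨ a = WeihrauchDegree.infty) ∧
    (∀ a : WeihrauchDegree, a ≠ WeihrauchDegree.zero → a ≠ WeihrauchDegree.infty →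
      ∃ b c : WeihrauchDegree, a < b ∧ a < c ∧ a = b ⊓ c) := by
  refine ⟨fun a => ⟨fun h => ?_, ?_⟩, fun a => WeihrauchDegree.exists_lt_lt_eq_inf⟩
  · by_contra! hn
    obtain ⟨b, c, hb, hc, e⟩ := WeihrauchDegree.exists_lt_lt_eq_inf hn.1 hn.2
    exact (h b c e).elim hb.ne hc.ne
  · rintro (rfl | rfl)
    exacts [WeihrauchDegree.meetIrreducible_zero, WeihrauchDegree.meetIrreducible_infty]
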